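/- Let $n\ge 3$ and $m\ge 1$, and let $g$ be the pseudo-Euclidean metric on $\mathbb{R}^n$ with $g_{ij}=\delta_{ij}\varepsilon_i$, $\varepsilon_i=\pm1$, in the coordinates $x=(x_1,\dots,x_n)$. Let $\varphi,f:\mathbb{R}^n\to\mathbb{R}$ be smooth functions with $\varphi$ nowhere zero and $f>0$, and let $(F^m,g_F)$ be a non-empty semi-Riemannian Einstein manifold of dimension $m$ with $\mathrm{Ric}_{g_F}=\lambda_F\,g_F$, $\lambda_F\in\mathbb{R}$ (so $\lambda_F=0$ if $m=1$). Let $M=(\mathbb{R}^n,\overline g)\times_f F^m$ be the warped product with $\overline g=\varphi^{-2}g$, that is, $\mathbb{R}^n\times F$ with the metric $\widetilde g=\overline g+f^2g_F$, and let $\lambda\in\mathbb{R}$. Write $u_{,x_i}$ and $u_{,x_ix_j}$ for the first and second order partial derivatives of $u$. Then $\widetilde g$ is Einstein with constant $\lambda$, that is, $\mathrm{Ric}_{\widetilde g}=\lambda\,\widetilde g$, if and only if at every point of $\mathbb{R}^n$ $$(n-2)f\varphi_{,x_ix_j}-m\varphi f_{,x_ix_j}-m\varphi_{,x_i}f_{,x_j}-m\varphi_{,x_j}f_{,x_i}=0\qquad\text{for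 all } i\ne j,$$ $$\varphi\bigl[(n-2)f\varphi_{,x_ix_i}-m\varphi f_{,x_ix_i}-2m\varphi_{,x_i}f_{,x_i}\bigr]+\varepsilon_i\Bigl[f\varphi\sum_{k=1}^n\varepsilon_k\varphi_{,x_kx_k}-(n-1)f\sum_{k=1}^n\varepsilon_k\varphi_{,x_k}^2+m\varphi\sum_{k=1}^n\varepsilon_k\varphi_{,x_k}f_{,x_k}\Bigr]=\varepsilon_i\lambda f\qquad\text{for all } i,$$ $$-f\varphi^2\sum_{k=1}^n\varepsilon_kf_{,x_kx_k}+(n-2)f\varphi\sum_{k=1}^n\varepsilon_kf_{,x_k}\varphi_{,x_k}-(m-1)\varphi^2\sum_{k=1}^n\varepsilon_kf_{,x_k}^2=\lambda f^2-\lambda_F.$$ -/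

import Mathlib

open Set
open scoped Manifold ContDiff Topology

set_option maxSynthPendingDepth 3

noncomputable section

section Coordinates

variable {E : Type*} [NormedAddCommGroup E] [NormedSpace ℝ E]

/-- Christoffel symbols of the first kind of a metric `G` given on (a part of) a vector space:
`K(u, v)(w) = (D_u G (v, w) + D_v G (u, w) - D_w G (u, v)) / 2`. -/
def christoffelFirst (G : E → E →L[ℝ] E →L[ℝ] ℝ) (y : E) : E →L[ℝ] E →L[ℝ] E →L[ℝ] ℝ :=
  (1 / 2 : ℝ) • (fderiv ℝ G y + (fderiv ℝ G y).flip -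
    ((ContinuousLinearMap.flipₗᵢ ℝ E E ℝ).toContinuousLinearEquiv.toContinuousLinearMap).comp
      (fderiv ℝ G y).flip)

/-- Christoffel symbols of the second kind: the last index of `christoffelFirst` is raised with
the inverse of `G y`, seen as an isomorphism from `E` onto its dual.  So `Γ(u, v)` is the vector
with `G(Γ(u, v), w) = K(u, v)(w)` for all `w`. -/
def christoffel (G : E → E →L[ℝ] E →L[ℝ] ℝ) (y : E) : E →L[ℝ] E →L[ℝ] E :=
  (ContinuousLinearMap.compL ℝ E (E →L[ℝ] ℝ) E (G y).inverse).comp (christoffelFirst G y)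

/-- For fixed `v`, `w`, the endomorphism `u ↦ R(u, v)w` of the curvature tensor
`R(u, v)w = ∇_u ∇_v w - ∇_v ∇_u w - ∇_[u, v] w` of the Levi-Civita connection of `G`. -/
def curvatureEndo (G : E → E →L[ℝ] E →L[ℝ] ℝ) (y v w : E) : E →L[ℝ] E :=
  ((fderiv ℝ (christoffel G) y).flip v).flip w - (fderiv ℝ (christoffel G) y v).flip w
    + (christoffel G y).flip (christoffel G y v w)
    - (christoffel G y v).comp ((christoffel G y).flip w)

/-- The Ricci tensor `Ric(v, w) = tr (u ↦ R(u, v)w)` of `G` at `y`. -/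
def ricciCoord (G : E → E →L[ℝ] E →L[ℝ] ℝ) (y v w : E) : ℝ :=
  LinearMap.trace ℝ E (curvatureEndo G y v w : E →ₗ[ℝ] E)

/-- `curvatureEndo` is the familiar expression
`DΓ(u)(v, w) - DΓ(v)(u, w) + Γ(u, Γ(v, w)) - Γ(v, Γ(u, w))`. -/
theorem curvatureEndo_apply (G : E → E →L[ℝ] E →L[ℝ] ℝ) (y v w u : E) :
    curvatureEndo G y v w u =
      fderiv ℝ (christoffel G) y u v w - fderiv ℝ (christoffel G) y v u w
        + christoffel G y u (christoffel G y v w) - christoffel G y v (christoffel G y u w) :=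
  rfl

theorem christoffelFirst_apply (G : E → E →L[ℝ] E →L[ℝ] ℝ) (y u v w : E) :
    christoffelFirst G y u v w =
      (1 / 2) * (fderiv ℝ G y u v w + fderiv ℝ G y v u w - fderiv ℝ G y w u v) :=
  rfl

end Coordinates

section Manifolds

variable {E : Type*} [NormedAddCommGroup E] [NormedSpace ℝ E]
  {H : Type*} [TopologicalSpace H] (I : ModelWithCorners ℝ E H)
  {M : Type*} [TopologicalSpace M] [ChartedSpace H M]

/-- The expression in the preferred chart at `p` of a field `g` of bilinear forms on the tangent
spaces of `M`, that is, its pullback under the inverse of the chart. -/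
def chartRep (g : ∀ q : M, TangentSpace I q →L[ℝ] TangentSpace I q →L[ℝ] ℝ) (p : M) (y : E) :
    E →L[ℝ] E →L[ℝ] ℝ :=
  ContinuousLinearMap.bilinearComp (E := E) (F := E) (G := ℝ) (E' := E) (F' := E)
    (g ((extChartAt I p).symm y))
    (mfderivWithin 𝓘(ℝ, E) I (extChartAt I p).symm (range I) y)
    (mfderivWithin 𝓘(ℝ, E) I (extChartAt I p).symm (range I) y)

theorem chartRep_apply (g : ∀ q : M, TangentSpace I q →L[ℝ] TangentSpace I q →L[ℝ] ℝ)
    (p : M) (y v w : E) :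
    chartRep I g p y v w = g ((extChartAt I p).symm y)
      (mfderivWithin 𝓘(ℝ, E) I (extChartAt I p).symm (range I) y v)
      (mfderivWithin 𝓘(ℝ, E) I (extChartAt I p).symm (range I) y w) :=
  rfl

variable (M) in
/-- A semi-Riemannian metric: a smooth field of nondegenerate symmetric bilinear forms, of
arbitrary signature, on the tangent spaces. -/
structure SemiRiemannianMetric where
  form : ∀ p : M, TangentSpace I p →L[ℝ] TangentSpace I p →L[ℝ] ℝ
  symm : ∀ p v w, form p v w = form p w v
  nondegenerate : ∀ p v, (∀ w, form p v w = 0) → v = 0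
  smooth : ∀ p, ContDiffOn ℝ ∞ (chartRep I form p) (extChartAt I p).target

variable {I}

/-- The Ricci tensor of a semi-Riemannian metric on a finite-dimensional manifold at `p`, computed
in the preferred chart at `p`.  (The Ricci tensor is a tensor, so any chart gives this value.) -/
def SemiRiemannianMetric.ricci (g : SemiRiemannianMetric I M) (p : M)
    (v w : TangentSpace I p) : ℝ :=
  ricciCoord (chartRep I g.form p) (extChartAt I p p)
    (mfderiv I 𝓘(ℝ, E) (extChartAt I p) p v) (mfderiv I 𝓘(ℝ, E) (extChartAt I p) p w)

/-- `g` is Einstein with constant Ricci curvature `lam`: `Ric = lam g`. -/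
def SemiRiemannianMetric.IsEinstein (g : SemiRiemannianMetric I M) (lam : ℝ) : Prop :=
  ∀ (p : M) (v w : TangentSpace I p), g.ricci p v w = lam * g.form p v w

/-- The bilinear forms `φ⁻² g`. -/
def conformalForm (g : SemiRiemannianMetric I M) (φ : M → ℝ) (p : M) :
    TangentSpace I p →L[ℝ] TangentSpace I p →L[ℝ] ℝ :=
  (φ p ^ 2)⁻¹ • g.form p

theorem conformalForm_apply (g : SemiRiemannianMetric I M) (φ : M → ℝ) (p : M)
    (v w : TangentSpace I p) : conformalForm g φ p v w = (φ p ^ 2)⁻¹ * g.form p v w :=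
  rfl

theorem chartRep_conformalForm (g : SemiRiemannianMetric I M) (φ : M → ℝ) (p : M) (y : E) :
    chartRep I (conformalForm g φ) p y =
      (φ ((extChartAt I p).symm y) ^ 2)⁻¹ • chartRep I g.form p y := by
  ext v w
  rfl

/-- The conformal metric `φ⁻² g`, for a smooth function `φ` without zeros. -/
def SemiRiemannianMetric.conformal [IsManifold I ∞ M] (g : SemiRiemannianMetric I M) (φ : M → ℝ)
    (hφ : ContMDiff I 𝓘(ℝ, ℝ) ∞ φ) (hφ0 : ∀ p, φ p ≠ 0) : SemiRiemannianMetric I M where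
  form := conformalForm g φ
  symm p v w := by
    rw [conformalForm_apply, conformalForm_apply, g.symm]
  nondegenerate p v h := by
    refine g.nondegenerate p v fun w => ?_
    have h1 := h w
    rw [conformalForm_apply] at h1
    exact (mul_eq_zero.mp h1).resolve_left (inv_ne_zero (pow_ne_zero 2 (hφ0 p)))
  smooth p := by
    have h1 : ContDiffOn ℝ ∞ (fun y => φ ((extChartAt I p).symm y)) (extChartAt I p).target :=
      contMDiffOn_iff_contDiffOn.mp
        (hφ.comp_contMDiffOn (contMDiffOn_extChartAt_symm (n := ∞) p))
    have h2 : ContDiffOn ℝ ∞ (fun y => (φ ((extChartAt I p).symm y) ^ 2)⁻¹)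
        (extChartAt I p).target :=
      (h1.pow 2).inv fun y _ => pow_ne_zero 2 (hφ0 _)
    exact (h2.smul (g.smooth p)).congr fun y _ => chartRep_conformalForm g φ p y

end Manifolds

section Warped

variable {E E' : Type*} [NormedAddCommGroup E] [NormedSpace ℝ E]
  [NormedAddCommGroup E'] [NormedSpace ℝ E']
  {H H' : Type*} [TopologicalSpace H] [TopologicalSpace H']
  {I : ModelWithCorners ℝ E H} {J : ModelWithCorners ℝ E' H'}
  {B F : Type*} [TopologicalSpace B] [ChartedSpace H B] [TopologicalSpace F] [ChartedSpace H' F]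

/-- The bilinear forms `π^* g_B + (f ∘ π)² σ^* g_F` on the tangent spaces of `B × F`, where `π`
and `σ` are the projections. -/
def warpedForm (gB : SemiRiemannianMetric I B) (f : B → ℝ) (gF : SemiRiemannianMetric J F)
    (p : B × F) :
    TangentSpace (I.prod J) p →L[ℝ] TangentSpace (I.prod J) p →L[ℝ] ℝ :=
  ContinuousLinearMap.bilinearComp (E := E) (F := E) (G := ℝ) (E' := E × E') (F' := E × E')
      (gB.form p.1)
      (mfderiv (I.prod J) I Prod.fst p) (mfderiv (I.prod J) I Prod.fst p) +
    (f p.1 ^ 2) •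
      ContinuousLinearMap.bilinearComp (E := E') (F := E') (G := ℝ) (E' := E × E') (F' := E × E')
        (gF.form p.2)
        (mfderiv (I.prod J) J Prod.snd p) (mfderiv (I.prod J) J Prod.snd p)

theorem warpedForm_apply (gB : SemiRiemannianMetric I B) (f : B → ℝ)
    (gF : SemiRiemannianMetric J F) (p : B × F) (v w : TangentSpace (I.prod J) p) :
    warpedForm gB f gF p v w =
      gB.form p.1 (mfderiv (I.prod J) I Prod.fst p v) (mfderiv (I.prod J) I Prod.fst p w) +
        f p.1 ^ 2 *
          gF.form p.2 (mfderiv (I.prod J) J Prod.snd p v) (mfderiv (I.prod J) J Prod.snd p w) :=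
  rfl

theorem chartRep_warpedForm [IsManifold I ∞ B] [IsManifold J ∞ F]
    (gB : SemiRiemannianMetric I B) (f : B → ℝ) (gF : SemiRiemannianMetric J F) (p : B × F)
    (y : E × E') (hy : y ∈ (extChartAt (I.prod J) p).target) :
    chartRep (I.prod J) (warpedForm gB f gF) p y =
      (chartRep I gB.form p.1 y.1).bilinearComp (ContinuousLinearMap.fst ℝ E E')
        (ContinuousLinearMap.fst ℝ E E') +
      (f ((extChartAt I p.1).symm y.1) ^ 2) •
        (chartRep J gF.form p.2 y.2).bilinearComp (ContinuousLinearMap.snd ℝ E E')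
          (ContinuousLinearMap.snd ℝ E E') := by
  have : IsManifold I 1 B := IsManifold.of_le (n := ∞) (by simp)
  have : IsManifold J 1 F := IsManifold.of_le (n := ∞) (by simp)
  rw [extChartAt_prod, PartialEquiv.prod_target] at hy
  have hB := mdifferentiableWithinAt_extChartAt_symm hy.1
  have hF := mdifferentiableWithinAt_extChartAt_symm hy.2
  have hd : mfderivWithin 𝓘(ℝ, E × E') (I.prod J) (extChartAt (I.prod J) p).symm
      (range (I.prod J)) y =
      (mfderivWithin 𝓘(ℝ, E) I (extChartAt I p.1).symm (range I) y.1).prodMap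
        (mfderivWithin 𝓘(ℝ, E') J (extChartAt J p.2).symm (range J) y.2) := by
    rw [extChartAt_prod, modelWithCorners_prod_coe, range_prodMap, modelWithCornersSelf_prod,
      ← chartedSpaceSelf_prod]
    exact mfderivWithin_prodMap hB hF
      (I.uniqueDiffOn.uniqueMDiffOn _ (extChartAt_target_subset_range _ hy.1))
      (J.uniqueDiffOn.uniqueMDiffOn _ (extChartAt_target_subset_range _ hy.2))
  refine ContinuousLinearMap.ext fun v => ContinuousLinearMap.ext fun w => ?_
  rw [chartRep_apply, warpedForm_apply, mfderiv_fst, mfderiv_snd, hd, extChartAt_prod]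
  rfl

/-- The warped product metric `g_B + f² g_F` on `B × F`, for a positive smooth function `f` on
`B`. -/
def SemiRiemannianMetric.warped [IsManifold I ∞ B] [IsManifold J ∞ F]
    (gB : SemiRiemannianMetric I B) (f : B → ℝ) (hf : ContMDiff I 𝓘(ℝ, ℝ) ∞ f)
    (hf0 : ∀ x, 0 < f x) (gF : SemiRiemannianMetric J F) :
    SemiRiemannianMetric (I.prod J) (B × F) where
  form := warpedForm gB f gF
  symm p v w := by
    rw [warpedForm_apply, warpedForm_apply, gB.symm, gF.symm]
  nondegenerate p v h := by
    have key : ∀ (w₁ : TangentSpace I p.1) (w₂ : TangentSpace J p.2),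
        gB.form p.1 v.1 w₁ + f p.1 ^ 2 * gF.form p.2 v.2 w₂ = 0 := by
      intro w₁ w₂
      have h1 := (warpedForm_apply gB f gF p v (w₁, w₂)).symm.trans (h (w₁, w₂))
      rw [mfderiv_fst, mfderiv_snd] at h1
      exact h1
    refine Prod.ext (gB.nondegenerate p.1 v.1 fun w => ?_) (gF.nondegenerate p.2 v.2 fun w => ?_)
    · have h1 := key w 0
      rw [map_zero, mul_zero, add_zero] at h1
      exact h1
    · have h1 := key 0 w
      rw [map_zero, zero_add] at h1
      exact (mul_eq_zero.mp h1).resolve_left (pow_ne_zero 2 (hf0 p.1).ne')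
  smooth p := by
    have hfst : MapsTo (Prod.fst : E × E' → E) (extChartAt (I.prod J) p).target
        (extChartAt I p.1).target := by
      intro y hy
      rw [extChartAt_prod, PartialEquiv.prod_target] at hy
      exact hy.1
    have hsnd : MapsTo (Prod.snd : E × E' → E') (extChartAt (I.prod J) p).target
        (extChartAt J p.2).target := by
      intro y hy
      rw [extChartAt_prod, PartialEquiv.prod_target] at hy
      exact hy.2
    have h1 : ContDiffOn ℝ ∞ (fun y => f ((extChartAt I p.1).symm y)) (extChartAt I p.1).target :=
      contMDiffOn_iff_contDiffOn.mp
        (hf.comp_contMDiffOn (contMDiffOn_extChartAt_symm (n := ∞) p.1))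
    have h2 : ContDiffOn ℝ ∞ (fun y : E × E' => f ((extChartAt I p.1).symm y.1) ^ 2)
        (extChartAt (I.prod J) p).target :=
      (h1.comp contDiff_fst.contDiffOn hfst).pow 2
    have hB : ContDiffOn ℝ ∞ (fun y : E × E' =>
        (chartRep I gB.form p.1 y.1).bilinearComp (ContinuousLinearMap.fst ℝ E E')
          (ContinuousLinearMap.fst ℝ E E')) (extChartAt (I.prod J) p).target :=
      contDiffOn_const.clm_comp (g := fun _ =>
        (ContinuousLinearMap.compL ℝ (E × E') E ℝ).flip (ContinuousLinearMap.fst ℝ E E'))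
        (((gB.smooth p.1).comp contDiff_fst.contDiffOn hfst).clm_comp contDiffOn_const)
    have hF : ContDiffOn ℝ ∞ (fun y : E × E' =>
        (chartRep J gF.form p.2 y.2).bilinearComp (ContinuousLinearMap.snd ℝ E E')
          (ContinuousLinearMap.snd ℝ E E')) (extChartAt (I.prod J) p).target :=
      contDiffOn_const.clm_comp (g := fun _ =>
        (ContinuousLinearMap.compL ℝ (E × E') E' ℝ).flip (ContinuousLinearMap.snd ℝ E E'))
        (((gF.smooth p.2).comp contDiff_snd.contDiffOn hsnd).clm_comp contDiffOn_const)
    exact (hB.add (h2.smul hF)).congr fun y hy => chartRep_warpedForm gB f gF p y hy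

end Warped

section PseudoEuclidean

/-- The bilinear form `∑ ε_i v_i w_i` on `ℝⁿ`. -/
def pseudoEuclideanForm {n : ℕ} (ε : Fin n → ℝ) :
    EuclideanSpace ℝ (Fin n) →L[ℝ] EuclideanSpace ℝ (Fin n) →L[ℝ] ℝ :=
  ∑ i, ε i • (EuclideanSpace.proj i : EuclideanSpace ℝ (Fin n) →L[ℝ] ℝ).smulRight
    (EuclideanSpace.proj i : EuclideanSpace ℝ (Fin n) →L[ℝ] ℝ)

theorem pseudoEuclideanForm_apply {n : ℕ} (ε : Fin n → ℝ) (v w : EuclideanSpace ℝ (Fin n)) :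
    pseudoEuclideanForm ε v w = ∑ i, ε i * (v i * w i) := by
  simp [pseudoEuclideanForm]

theorem pseudoEuclideanForm_symm {n : ℕ} (ε : Fin n → ℝ) (v w : EuclideanSpace ℝ (Fin n)) :
    pseudoEuclideanForm ε v w = pseudoEuclideanForm ε w v := by
  simp only [pseudoEuclideanForm_apply, mul_comm (v _)]

theorem pseudoEuclideanForm_nondegenerate {n : ℕ} (ε : Fin n → ℝ)
    (hε : ∀ i, ε i = 1 ∨ ε i = -1) (v : EuclideanSpace ℝ (Fin n))
    (h : ∀ w, pseudoEuclideanForm ε v w = 0) : v = 0 := by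
  refine PiLp.ext fun i => ?_
  have h1 := h (EuclideanSpace.single i 1)
  have h2 : ε i ≠ 0 := by rcases hε i with h | h <;> simp [h]
  simpa [pseudoEuclideanForm_apply, Pi.single_apply, h2] using h1

theorem chartRep_pseudoEuclidean {n : ℕ} (ε : Fin n → ℝ) (p y : EuclideanSpace ℝ (Fin n)) :
    chartRep (𝓡 n) (M := EuclideanSpace ℝ (Fin n)) (fun _ => pseudoEuclideanForm ε) p y =
      pseudoEuclideanForm ε := by
  have h : mfderivWithin (𝓡 n) (𝓡 n) (extChartAt (𝓡 n) p).symm (range (𝓡 n)) y =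
      ContinuousLinearMap.id ℝ (EuclideanSpace ℝ (Fin n)) := by
    simp only [mfld_simps, mfderivWithin_univ]
    exact mfderiv_id
  unfold chartRep
  rw [h]
  rfl

/-- The pseudo-Euclidean metric `g_ij = δ_ij ε_i` on `ℝⁿ`, with signs `ε_i = ±1`. -/
def pseudoEuclidean {n : ℕ} (ε : Fin n → ℝ) (hε : ∀ i, ε i = 1 ∨ ε i = -1) :
    SemiRiemannianMetric (𝓡 n) (EuclideanSpace ℝ (Fin n)) where
  form _ := pseudoEuclideanForm ε
  symm _ := pseudoEuclideanForm_symm ε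
  nondegenerate _ := pseudoEuclideanForm_nondegenerate ε hε
  smooth p := contDiffOn_const.congr fun y _ => chartRep_pseudoEuclidean ε p y

/-- The partial derivative `u_{,x_i}`. -/
def pd {n : ℕ} (i : Fin n) (u : EuclideanSpace ℝ (Fin n) → ℝ) (x : EuclideanSpace ℝ (Fin n)) : ℝ :=
  fderiv ℝ u x (EuclideanSpace.single i 1)

end PseudoEuclidean

end

/-!
The Ricci tensor of a warped product `G + f² G'` with fibre of dimension `m` is

  `Ric_G - (m / f) Hess_G f + Ric_G' - (f Δ_G f + (m - 1) |∇f|²_G) G'`,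

where `Ric_G` and `Hess_G f` see only the base components of the arguments and `Ric_G'` and `G'`
only the fibre components (`ricciCoord_warpedCoord`).  It is computed in coordinates: the Koszul
formula determines the Christoffel symbols (`christoffel_eq`), and the trace defining the Ricci
tensor is the sum of the traces of the two diagonal blocks of the curvature endomorphism.

For `G = φ⁻² B` with `B` constant and base dimension `n`, the Christoffel symbols are explicit, every
term of the curvature endomorphism is built from maps of rank one, the identity and the derivative of
the gradient, and taking traces yields
`Ric_G = (n - 2) φ⁻¹ Hess φ + (φ⁻¹ Δφ - (n - 1) φ⁻² |∇φ|²) B` (`ricciCoord_conformalCoord`), as well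
as the Hessian, the gradient and the Laplacian of `f` with respect to `G`.

The preferred chart at a point has the identity as derivative there, and the chart expression of the
warped product is the warped product of the chart expressions, so the Einstein equation at a point is
the coordinate equation (`isEinstein_warped_iff`).  As `Ric = λ_F g_F` on the fibre, it splits into an
equation of bilinear forms on `ℝⁿ`, which gives the first two families of equations on the standard
basis, and an equation for the coefficient of `g_F`, which gives the third because `g_F ≠ 0`.
-/

noncomputable section

/-! ### Metrics in coordinates -/

section Coordinates

variable {E : Type*} [NormedAddCommGroup E] [NormedSpace ℝ E]

/-- `G` is, near `y`, the coordinate expression of a semi-Riemannian metric of class `C²`: a field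
of symmetric bilinear forms, nondegenerate at `y`.  Nondegeneracy is phrased as invertibility of the
induced map into the dual, an open condition.  Symmetry is required everywhere, which chart
expressions of metrics satisfy even outside the target of the chart. -/
structure IsMetricAt (G : E → E →L[ℝ] E →L[ℝ] ℝ) (y : E) : Prop where
  symm : ∀ z v w, G z v w = G z w v
  contDiffAt : ContDiffAt ℝ 2 G y
  isInvertible : (G y).IsInvertible

/-- The gradient of `f` with respect to `G`. -/
def coordGrad (G : E → E →L[ℝ] E →L[ℝ] ℝ) (f : E → ℝ) (y : E) : E :=
  (G y).inverse (fderiv ℝ f y)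

/-- The covariant Hessian of `f` with respect to `G`. -/
def coordHess (G : E → E →L[ℝ] E →L[ℝ] ℝ) (f : E → ℝ) (y v w : E) : ℝ :=
  fderiv ℝ (fderiv ℝ f) y v w - fderiv ℝ f y (christoffel G y v w)

/-- The Laplacian of `f` with respect to `G`, as the trace of the covariant derivative
`u ↦ ∇_u grad f` of the gradient. -/
def coordLaplacian (G : E → E →L[ℝ] E →L[ℝ] ℝ) (f : E → ℝ) (y : E) : ℝ :=
  LinearMap.trace ℝ E
    ((fderiv ℝ (coordGrad G f) y + (christoffel G y).flip (coordGrad G f y) : E →L[ℝ] E) :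
      E →ₗ[ℝ] E)

theorem isInvertible_of_nondegenerate [FiniteDimensional ℝ E] {B : E →L[ℝ] E →L[ℝ] ℝ}
    (hB : ∀ v, (∀ w, B v w = 0) → v = 0) : B.IsInvertible := by
  have hinj : Function.Injective (B : E →ₗ[ℝ] E →L[ℝ] ℝ) := by
    rw [← LinearMap.ker_eq_bot, LinearMap.ker_eq_bot']
    intro v hv
    refine hB v fun w => ?_
    have : B v = 0 := hv
    simp [this]
  have hfin : Module.finrank ℝ E = Module.finrank ℝ (E →L[ℝ] ℝ) := by
    rw [← Subspace.dual_finrank_eq (K := ℝ) (V := E)]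
    exact (LinearMap.toContinuousLinearMap (𝕜 := ℝ) (E := E) (F' := ℝ)).finrank_eq
  refine ⟨(LinearEquiv.ofInjectiveOfFinrankEq (B : E →ₗ[ℝ] E →L[ℝ] ℝ) hinj hfin
    ).toContinuousLinearEquiv, ?_⟩
  ext v w
  rfl

theorem nondegenerate_of_isInvertible {B : E →L[ℝ] E →L[ℝ] ℝ} (hB : B.IsInvertible) {v : E}
    (h : ∀ w, B v w = 0) : v = 0 :=
  hB.injective (by rw [map_zero]; exact ContinuousLinearMap.ext h)

theorem fderiv_bilin_apply {G : E → E →L[ℝ] E →L[ℝ] ℝ} {y : E} (hG : DifferentiableAt ℝ G y)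
    {v w : E} {c : E →L[ℝ] ℝ} (hc : HasFDerivAt (fun z => G z v w) c y) (u : E) :
    fderiv ℝ G y u v w = c u := by
  have h := (hG.hasFDerivAt.clm_apply (hasFDerivAt_const v y)).clm_apply (hasFDerivAt_const w y)
  rw [hc.unique h]
  simp

/-- The derivative of the Christoffel symbols can be computed componentwise, from a formula `c` for
one (vector-valued) component that holds near the point. -/
theorem fderiv_christoffel_apply {G : E → E →L[ℝ] E →L[ℝ] ℝ} {y : E}
    (hG : DifferentiableAt ℝ (christoffel G) y) {F : Type*} [NormedAddCommGroup F]
    [NormedSpace ℝ F] (L : E →L[ℝ] F) {v w : E} {c : E → F} {c' : E →L[ℝ] F}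
    (hev : ∀ᶠ z in 𝓝 y, L (christoffel G z v w) = c z) (hc : HasFDerivAt c c' y) (u : E) :
    L (fderiv ℝ (christoffel G) y u v w) = c' u := by
  have h := L.hasFDerivAt.comp y
    ((hG.hasFDerivAt.clm_apply (hasFDerivAt_const v y)).clm_apply (hasFDerivAt_const w y))
  have h2 := hc.congr_of_eventuallyEq hev
  rw [h2.unique h]
  simp

theorem christoffel_congr {G G' : E → E →L[ℝ] E →L[ℝ] ℝ} {y : E} (h : G =ᶠ[𝓝 y] G') :
    christoffel G y = christoffel G' y := by
  unfold christoffel christoffelFirst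
  rw [h.fderiv_eq, h.eq_of_nhds]

theorem ricciCoord_congr {G G' : E → E →L[ℝ] E →L[ℝ] ℝ} {y : E} (h : G =ᶠ[𝓝 y] G') :
    ricciCoord G y = ricciCoord G' y := by
  have h1 : christoffel G =ᶠ[𝓝 y] christoffel G' :=
    h.eventuallyEq_nhds.mono fun z hz => christoffel_congr hz
  funext v w
  unfold ricciCoord curvatureEndo
  rw [h1.fderiv_eq, h1.eq_of_nhds]

/-- The Koszul formula determines the Christoffel symbols of the second kind. -/
theorem christoffel_eq {G : E → E →L[ℝ] E →L[ℝ] ℝ} {y : E} (hG : (G y).IsInvertible) {u v z : E}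
    (h : ∀ w, G y z w = christoffelFirst G y u v w) : christoffel G y u v = z :=
  (hG.inverse_apply_eq).2 (ContinuousLinearMap.ext fun w => (h w).symm)

theorem apply_christoffel {G : E → E →L[ℝ] E →L[ℝ] ℝ} {y : E} (hG : (G y).IsInvertible)
    (u v w : E) : G y (christoffel G y u v) w = christoffelFirst G y u v w :=
  congrArg (fun L : E →L[ℝ] ℝ => L w) (hG.self_apply_inverse (christoffelFirst G y u v))

theorem apply_coordGrad {G : E → E →L[ℝ] E →L[ℝ] ℝ} {y : E} (hG : (G y).IsInvertible) (f : E → ℝ)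
    (w : E) : G y (coordGrad G f y) w = fderiv ℝ f y w :=
  congrArg (fun L : E →L[ℝ] ℝ => L w) (hG.self_apply_inverse (fderiv ℝ f y))

namespace IsMetricAt

variable {G : E → E →L[ℝ] E →L[ℝ] ℝ} {y : E}

theorem differentiableAt (hG : IsMetricAt G y) : DifferentiableAt ℝ G y :=
  hG.contDiffAt.differentiableAt (by norm_num)

theorem christoffel_symm (hG : IsMetricAt G y) (u v : E) :
    christoffel G y u v = christoffel G y v u := by
  have hs : ∀ a b c, fderiv ℝ G y a b c = fderiv ℝ G y a c b := by
    intro a b c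
    have h := (hG.differentiableAt.hasFDerivAt.clm_apply (hasFDerivAt_const b y)).clm_apply
      (hasFDerivAt_const c y)
    rw [fderiv_bilin_apply hG.differentiableAt (h.congr_of_eventuallyEq
      (Filter.Eventually.of_forall fun z => hG.symm z c b))]
    simp
  refine christoffel_eq hG.isInvertible fun w => ?_
  rw [apply_christoffel hG.isInvertible, christoffelFirst_apply, christoffelFirst_apply, hs w u v]
  ring

variable [FiniteDimensional ℝ E]

theorem contDiffAt_inverse (hG : IsMetricAt G y) :
    ContDiffAt ℝ 2 (fun z => (G z).inverse) y := by
  have : CompleteSpace E := FiniteDimensional.complete ℝ E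
  exact hG.isInvertible.contDiffAt_map_inverse.comp y hG.contDiffAt

theorem differentiableAt_christoffel (hG : IsMetricAt G y) :
    DifferentiableAt ℝ (christoffel G) y := by
  have h1 : DifferentiableAt ℝ (fderiv ℝ G) y :=
    (hG.contDiffAt.fderiv_right (m := 1) (by norm_num)).differentiableAt (by norm_num)
  have h2 : DifferentiableAt ℝ (fun z => (G z).inverse) y :=
    hG.contDiffAt_inverse.differentiableAt (by norm_num)
  have h3 : DifferentiableAt ℝ (fun z => (fderiv ℝ G z).flip) y :=
    ((ContinuousLinearMap.flipₗᵢ ℝ E E (E →L[ℝ] ℝ)).toContinuousLinearEquiv.toContinuousLinearMap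
      ).differentiableAt.comp y h1
  have h4 : DifferentiableAt ℝ (christoffelFirst G) y :=
    (((h1.add h3).sub ((differentiableAt_const _).clm_comp h3)).const_smul (1 / 2 : ℝ))
  exact ((ContinuousLinearMap.compL ℝ E (E →L[ℝ] ℝ) E).differentiableAt.comp y h2).clm_comp h4

theorem differentiableAt_coordGrad (hG : IsMetricAt G y) {f : E → ℝ} (hf : ContDiffAt ℝ 2 f y) :
    DifferentiableAt ℝ (coordGrad G f) y := by
  have h1 : DifferentiableAt ℝ (fderiv ℝ f) y :=
    (hf.fderiv_right (m := 1) (by norm_num)).differentiableAt (by norm_num)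
  exact (hG.contDiffAt_inverse.differentiableAt (by norm_num)).clm_apply h1

theorem eventually (hG : IsMetricAt G y) : ∀ᶠ z in 𝓝 y, IsMetricAt G z := by
  have : CompleteSpace E := FiniteDimensional.complete ℝ E
  obtain ⟨e, he⟩ := hG.isInvertible
  have h1 : ∀ᶠ B in 𝓝 (G y), B.IsInvertible := by
    rw [← he]
    exact (ContinuousLinearEquiv.nhds e)
  filter_upwards [hG.contDiffAt.continuousAt.eventually h1,
    hG.contDiffAt.eventually (by simp)] with z h2 h3
  exact ⟨hG.symm, h3, h2⟩

end IsMetricAt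

end Coordinates

/-! ### Ricci tensor of a warped product -/

/-- The trace of an endomorphism of a product is the sum of the traces of its diagonal blocks. -/
theorem LinearMap.trace_prod {V W : Type*} [AddCommGroup V] [Module ℝ V] [AddCommGroup W]
    [Module ℝ W] [FiniteDimensional ℝ V] [FiniteDimensional ℝ W] (A : V × W →ₗ[ℝ] V × W) :
    LinearMap.trace ℝ (V × W) A =
      LinearMap.trace ℝ V (LinearMap.fst ℝ V W ∘ₗ A ∘ₗ LinearMap.inl ℝ V W) +
        LinearMap.trace ℝ W (LinearMap.snd ℝ V W ∘ₗ A ∘ₗ LinearMap.inr ℝ V W) := by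
  have h : A = (A ∘ₗ LinearMap.inl ℝ V W) ∘ₗ LinearMap.fst ℝ V W +
      (A ∘ₗ LinearMap.inr ℝ V W) ∘ₗ LinearMap.snd ℝ V W := by
    ext x <;> simp [Prod.mk_zero_zero]
  conv_lhs => rw [h, map_add, LinearMap.trace_comp_comm' (LinearMap.fst ℝ V W),
    LinearMap.trace_comp_comm' (LinearMap.snd ℝ V W)]

section WarpedCoordinates

variable {E E' : Type*} [NormedAddCommGroup E] [NormedSpace ℝ E]
  [NormedAddCommGroup E'] [NormedSpace ℝ E']

/-- The warped product `G + f² G'` of two metrics in coordinates. -/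
def warpedCoord (G : E → E →L[ℝ] E →L[ℝ] ℝ) (f : E → ℝ) (G' : E' → E' →L[ℝ] E' →L[ℝ] ℝ)
    (z : E × E') : E × E' →L[ℝ] E × E' →L[ℝ] ℝ :=
  (G z.1).bilinearComp (ContinuousLinearMap.fst ℝ E E') (ContinuousLinearMap.fst ℝ E E') +
    (f z.1 ^ 2) •
      (G' z.2).bilinearComp (ContinuousLinearMap.snd ℝ E E') (ContinuousLinearMap.snd ℝ E E')

variable {G : E → E →L[ℝ] E →L[ℝ] ℝ} {f : E → ℝ} {G' : E' → E' →L[ℝ] E' →L[ℝ] ℝ} {z : E × E'}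

theorem warpedCoord_apply (z v w : E × E') :
    warpedCoord G f G' z v w = G z.1 v.1 w.1 + f z.1 ^ 2 * G' z.2 v.2 w.2 :=
  rfl

theorem isMetricAt_warpedCoord [FiniteDimensional ℝ E] [FiniteDimensional ℝ E']
    (hG : IsMetricAt G z.1) (hG' : IsMetricAt G' z.2)
    (hf : ContDiffAt ℝ 2 f z.1) (hf0 : f z.1 ≠ 0) : IsMetricAt (warpedCoord G f G') z where
  symm x v w := by
    rw [warpedCoord_apply, warpedCoord_apply, hG.symm, hG'.symm]
  contDiffAt := by
    have h1 : ContDiffAt ℝ 2 (fun y : E × E' => G y.1) z := hG.contDiffAt.comp z contDiffAt_fst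
    have h2 : ContDiffAt ℝ 2 (fun y : E × E' => G' y.2) z := hG'.contDiffAt.comp z contDiffAt_snd
    have h3 : ContDiffAt ℝ 2 (fun y : E × E' => f y.1 ^ 2) z :=
      (ContDiffAt.comp z hf contDiffAt_fst).pow 2
    exact (contDiffAt_const.clm_comp (g := fun _ =>
        (ContinuousLinearMap.compL ℝ (E × E') E ℝ).flip (ContinuousLinearMap.fst ℝ E E'))
        (h1.clm_comp contDiffAt_const)).add
      (h3.smul (contDiffAt_const.clm_comp (g := fun _ =>
        (ContinuousLinearMap.compL ℝ (E × E') E' ℝ).flip (ContinuousLinearMap.snd ℝ E E'))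
        (h2.clm_comp contDiffAt_const)))
  isInvertible := by
    refine isInvertible_of_nondegenerate fun v h => ?_
    refine Prod.ext (nondegenerate_of_isInvertible hG.isInvertible fun w => ?_)
      (nondegenerate_of_isInvertible hG'.isInvertible fun w => ?_)
    · simpa [warpedCoord_apply] using h (w, 0)
    · simpa [warpedCoord_apply, hf0] using h (0, w)

theorem fderiv_warpedCoord [FiniteDimensional ℝ E] [FiniteDimensional ℝ E']
    (hG : IsMetricAt G z.1) (hG' : IsMetricAt G' z.2)
    (hf : ContDiffAt ℝ 2 f z.1) (hf0 : f z.1 ≠ 0) (u v w : E × E') :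
    fderiv ℝ (warpedCoord G f G') z u v w =
      fderiv ℝ G z.1 u.1 v.1 w.1 + f z.1 ^ 2 * fderiv ℝ G' z.2 u.2 v.2 w.2 +
        2 * f z.1 * fderiv ℝ f z.1 u.1 * G' z.2 v.2 w.2 := by
  have hd1 : HasFDerivAt (fun y : E × E' => G y.1 v.1 w.1) _ z :=
    HasFDerivAt.comp (f := Prod.fst) z
      ((hG.differentiableAt.hasFDerivAt.clm_apply (hasFDerivAt_const v.1 _)).clm_apply
        (hasFDerivAt_const w.1 _)) hasFDerivAt_fst
  have hd2 : HasFDerivAt (fun y : E × E' => G' y.2 v.2 w.2) _ z :=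
    HasFDerivAt.comp (f := Prod.snd) z
      ((hG'.differentiableAt.hasFDerivAt.clm_apply (hasFDerivAt_const v.2 _)).clm_apply
        (hasFDerivAt_const w.2 _)) hasFDerivAt_snd
  have hd3 : HasFDerivAt (fun y : E × E' => f y.1) _ z :=
    HasFDerivAt.comp (f := Prod.fst) z
      (hf.differentiableAt (by norm_num)).hasFDerivAt hasFDerivAt_fst
  rw [fderiv_bilin_apply (isMetricAt_warpedCoord hG hG' hf hf0).differentiableAt
    (hd1.add ((hd3.pow 2).mul hd2))]
  simp
  ring

/-- The Christoffel symbols of `G + f² G'`, obtained by checking the Koszul formula. -/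
theorem christoffel_warpedCoord [FiniteDimensional ℝ E] [FiniteDimensional ℝ E']
    (hG : IsMetricAt G z.1) (hG' : IsMetricAt G' z.2)
    (hf : ContDiffAt ℝ 2 f z.1) (hf0 : f z.1 ≠ 0) (u v : E × E') :
    christoffel (warpedCoord G f G') z u v =
      (christoffel G z.1 u.1 v.1 - G' z.2 u.2 v.2 • f z.1 • coordGrad G f z.1,
        christoffel G' z.2 u.2 v.2 + (f z.1)⁻¹ • (fderiv ℝ f z.1 u.1 • v.2 +
          fderiv ℝ f z.1 v.1 • u.2)) := by
  refine christoffel_eq (isMetricAt_warpedCoord hG hG' hf hf0).isInvertible fun w => ?_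
  rw [warpedCoord_apply, christoffelFirst_apply, fderiv_warpedCoord hG hG' hf hf0,
    fderiv_warpedCoord hG hG' hf hf0, fderiv_warpedCoord hG hG' hf hf0]
  simp only [map_sub, map_add, map_smul, sub_apply,
    add_apply, smul_apply, smul_eq_mul,
    apply_christoffel hG.isInvertible, apply_christoffel hG'.isInvertible,
    apply_coordGrad hG.isInvertible, christoffelFirst_apply]
  field_simp
  ring

/-- The diagonal block of `u ↦ R(u, v)w` on the base.  Only the two diagonal blocks contribute to the
trace, so the mixed components of the curvature are not needed. -/
theorem curvatureEndo_warpedCoord_inl [FiniteDimensional ℝ E] [FiniteDimensional ℝ E']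
    (hG : IsMetricAt G z.1) (hG' : IsMetricAt G' z.2)
    (hf : ContDiffAt ℝ 2 f z.1) (hf0 : f z.1 ≠ 0) (v w : E × E') (u : E) :
    (curvatureEndo (warpedCoord G f G') z v w (u, 0)).1 =
      curvatureEndo G z.1 v.1 w.1 u - (G' z.2 v.2 w.2 * f z.1) •
        (fderiv ℝ (coordGrad G f) z.1 u + christoffel G z.1 u (coordGrad G f z.1)) := by
  have hW := isMetricAt_warpedCoord hG hG' hf hf0
  have hev : ∀ v w : E × E', ∀ᶠ y in 𝓝 z,
      ContinuousLinearMap.fst ℝ E E' (christoffel (warpedCoord G f G') y v w) =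
        christoffel G y.1 v.1 w.1 - G' y.2 v.2 w.2 • f y.1 • coordGrad G f y.1 := by
    intro v w
    filter_upwards [continuous_fst.continuousAt.eventually hG.eventually,
      continuous_snd.continuousAt.eventually hG'.eventually,
      continuous_fst.continuousAt.eventually (hf.eventually (by simp)),
      continuous_fst.continuousAt.eventually (hf.continuousAt.eventually_ne hf0)]
      with y h1 h2 h3 h4
    rw [christoffel_warpedCoord h1 h2 h3 h4]
    rfl
  have hd : ∀ v w : E × E', HasFDerivAt (fun y : E × E' =>
      christoffel G y.1 v.1 w.1 - G' y.2 v.2 w.2 • f y.1 • coordGrad G f y.1) _ z := fun v w =>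
    (HasFDerivAt.comp (f := Prod.fst) z
      ((hG.differentiableAt_christoffel.hasFDerivAt.clm_apply
        (hasFDerivAt_const v.1 _)).clm_apply (hasFDerivAt_const w.1 _)) hasFDerivAt_fst).sub
    ((HasFDerivAt.comp (f := Prod.snd) z
      ((hG'.differentiableAt.hasFDerivAt.clm_apply (hasFDerivAt_const v.2 _)).clm_apply
        (hasFDerivAt_const w.2 _)) hasFDerivAt_snd).smul
      (HasFDerivAt.comp (f := Prod.fst) z
        ((hf.differentiableAt (by norm_num)).hasFDerivAt.smul
          (hG.differentiableAt_coordGrad hf).hasFDerivAt) hasFDerivAt_fst))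
  have h1 := fderiv_christoffel_apply hW.differentiableAt_christoffel _ (hev v w) (hd v w) (u, 0)
  have h2 := fderiv_christoffel_apply hW.differentiableAt_christoffel _
    (hev (u, 0) w) (hd (u, 0) w) v
  simp only [ContinuousLinearMap.coe_fst'] at h1 h2
  rw [curvatureEndo_apply, curvatureEndo_apply]
  simp only [Prod.fst_add, Prod.fst_sub, h1, h2, christoffel_warpedCoord hG hG' hf hf0]
  simp
  match_scalars <;> field_simp
  ring

/-- The diagonal block of `u ↦ R(u, v)w` on the fibre.  The terms with Christoffel symbols of `G'`
times `df` cancel because these symbols are symmetric. -/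
theorem curvatureEndo_warpedCoord_inr [FiniteDimensional ℝ E] [FiniteDimensional ℝ E']
    (hG : IsMetricAt G z.1) (hG' : IsMetricAt G' z.2)
    (hf : ContDiffAt ℝ 2 f z.1) (hf0 : f z.1 ≠ 0) (v w : E × E') (u : E') :
    (curvatureEndo (warpedCoord G f G') z v w (0, u)).2 =
      curvatureEndo G' z.2 v.2 w.2 u
        - ((f z.1)⁻¹ * coordHess G f z.1 v.1 w.1 +
          G' z.2 v.2 w.2 * fderiv ℝ f z.1 (coordGrad G f z.1)) • u
        + (G' z.2 u w.2 * fderiv ℝ f z.1 (coordGrad G f z.1)) • v.2 := by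
  have hW := isMetricAt_warpedCoord hG hG' hf hf0
  have hev : ∀ v w : E × E', ∀ᶠ y in 𝓝 z,
      ContinuousLinearMap.snd ℝ E E' (christoffel (warpedCoord G f G') y v w) =
        christoffel G' y.2 v.2 w.2 + (f y.1)⁻¹ • (fderiv ℝ f y.1 v.1 • w.2 +
          fderiv ℝ f y.1 w.1 • v.2) := by
    intro v w
    filter_upwards [continuous_fst.continuousAt.eventually hG.eventually,
      continuous_snd.continuousAt.eventually hG'.eventually,
      continuous_fst.continuousAt.eventually (hf.eventually (by simp)),
      continuous_fst.continuousAt.eventually (hf.continuousAt.eventually_ne hf0)]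
      with y h1 h2 h3 h4
    rw [christoffel_warpedCoord h1 h2 h3 h4]
    rfl
  have hdf : DifferentiableAt ℝ (fderiv ℝ f) z.1 :=
    (hf.fderiv_right (m := 1) (by norm_num)).differentiableAt (by norm_num)
  have hdf' : ∀ a : E, HasFDerivAt (fun y : E × E' => fderiv ℝ f y.1 a) _ z := fun a =>
    HasFDerivAt.comp (f := Prod.fst) z
      (hdf.hasFDerivAt.clm_apply (hasFDerivAt_const a _)) hasFDerivAt_fst
  have hf1 : HasFDerivAt (fun y : E × E' => (f y.1)⁻¹) _ z :=
    HasFDerivAt.comp (f := Prod.fst) z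
      ((hasFDerivAt_inv hf0).comp z.1 (hf.differentiableAt (by norm_num)).hasFDerivAt)
      hasFDerivAt_fst
  have hd : ∀ v w : E × E', HasFDerivAt (fun y : E × E' =>
      christoffel G' y.2 v.2 w.2 + (f y.1)⁻¹ • (fderiv ℝ f y.1 v.1 • w.2 +
          fderiv ℝ f y.1 w.1 • v.2)) _ z := fun v w =>
    (HasFDerivAt.comp (f := Prod.snd) z
      ((hG'.differentiableAt_christoffel.hasFDerivAt.clm_apply
        (hasFDerivAt_const v.2 _)).clm_apply (hasFDerivAt_const w.2 _)) hasFDerivAt_snd).add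
    (hf1.smul (((hdf' v.1).smul_const w.2).add ((hdf' w.1).smul_const v.2)))
  have h1 := fderiv_christoffel_apply hW.differentiableAt_christoffel _ (hev v w) (hd v w) (0, u)
  have h2 := fderiv_christoffel_apply hW.differentiableAt_christoffel _
    (hev (0, u) w) (hd (0, u) w) v
  simp only [ContinuousLinearMap.coe_snd'] at h1 h2
  rw [curvatureEndo_apply, curvatureEndo_apply]
  simp only [Prod.snd_add, Prod.snd_sub, h1, h2, christoffel_warpedCoord hG hG' hf hf0]
  simp [coordHess]
  rw [hG'.christoffel_symm v.2 u]
  match_scalars <;> field_simp <;> ring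

/-- The Ricci tensor of a warped product. -/
theorem ricciCoord_warpedCoord [FiniteDimensional ℝ E] [FiniteDimensional ℝ E']
    (hG : IsMetricAt G z.1) (hG' : IsMetricAt G' z.2)
    (hf : ContDiffAt ℝ 2 f z.1) (hf0 : f z.1 ≠ 0) (v w : E × E') :
    ricciCoord (warpedCoord G f G') z v w =
      ricciCoord G z.1 v.1 w.1
        - Module.finrank ℝ E' * (f z.1)⁻¹ * coordHess G f z.1 v.1 w.1
        + ricciCoord G' z.2 v.2 w.2
        - (f z.1 * coordLaplacian G f z.1 +
          (Module.finrank ℝ E' - 1) * fderiv ℝ f z.1 (coordGrad G f z.1)) * G' z.2 v.2 w.2 := by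
  have h1 : LinearMap.fst ℝ E E' ∘ₗ (curvatureEndo (warpedCoord G f G') z v w : _ →ₗ[ℝ] _) ∘ₗ
      LinearMap.inl ℝ E E' = (curvatureEndo G z.1 v.1 w.1 : E →ₗ[ℝ] E) -
        (G' z.2 v.2 w.2 * f z.1) • ((fderiv ℝ (coordGrad G f) z.1 +
          (christoffel G z.1).flip (coordGrad G f z.1) : E →L[ℝ] E) : E →ₗ[ℝ] E) :=
    LinearMap.ext fun u => curvatureEndo_warpedCoord_inl hG hG' hf hf0 v w u
  have h2 : LinearMap.snd ℝ E E' ∘ₗ (curvatureEndo (warpedCoord G f G') z v w : _ →ₗ[ℝ] _) ∘ₗ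
      LinearMap.inr ℝ E E' = (curvatureEndo G' z.2 v.2 w.2 : E' →ₗ[ℝ] E') -
        ((f z.1)⁻¹ * coordHess G f z.1 v.1 w.1 +
          G' z.2 v.2 w.2 * fderiv ℝ f z.1 (coordGrad G f z.1)) • LinearMap.id +
        (fderiv ℝ f z.1 (coordGrad G f z.1)) •
          ((G' z.2).flip w.2 : E' →ₗ[ℝ] ℝ).smulRight v.2 := by
    refine LinearMap.ext fun u => (curvatureEndo_warpedCoord_inr hG hG' hf hf0 v w u).trans ?_
    simp [smul_smul, mul_comm]
  rw [ricciCoord, LinearMap.trace_prod, h1, h2]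
  simp only [map_sub, map_add, map_smul, LinearMap.trace_smulRight, LinearMap.trace_id,
    smul_eq_mul, ricciCoord, coordLaplacian, ContinuousLinearMap.coe_coe,
    ContinuousLinearMap.flip_apply]
  ring

end WarpedCoordinates

/-! ### Conformally flat metrics -/

section ConformalCoordinates

variable {E : Type*} [NormedAddCommGroup E] [NormedSpace ℝ E]

/-- The metric `φ⁻² B` in coordinates, where `B` has constant coefficients. -/
def conformalCoord (B : E →L[ℝ] E →L[ℝ] ℝ) (φ : E → ℝ) (y : E) : E →L[ℝ] E →L[ℝ] ℝ :=
  (φ y ^ 2)⁻¹ • B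

/-- The gradient of `f` with respect to the constant metric `B`. -/
abbrev flatGrad (B : E →L[ℝ] E →L[ℝ] ℝ) (f : E → ℝ) : E → E :=
  coordGrad (fun _ => B) f

/-- The Laplacian of `f` with respect to the constant metric `B`. -/
def flatLaplacian (B : E →L[ℝ] E →L[ℝ] ℝ) (f : E → ℝ) (y : E) : ℝ :=
  LinearMap.trace ℝ E (fderiv ℝ (flatGrad B f) y : E →ₗ[ℝ] E)

theorem ContDiffAt.differentiableAt_fderiv {f : E → ℝ} {y : E} (hf : ContDiffAt ℝ 2 f y) :
    DifferentiableAt ℝ (fderiv ℝ f) y :=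
  (hf.fderiv_right (m := 1) (by norm_num)).differentiableAt (by norm_num)

theorem hasFDerivAt_inv_sq {φ : E → ℝ} {y : E} (hφ : DifferentiableAt ℝ φ y) (hφ0 : φ y ≠ 0) :
    HasFDerivAt (fun z => (φ z ^ 2)⁻¹) ((-2 * (φ y ^ 3)⁻¹) • fderiv ℝ φ y) y := by
  refine ((hasDerivAt_inv (pow_ne_zero 2 hφ0)).comp_hasFDerivAt y
    (hφ.hasFDerivAt.pow 2)).congr_fderiv ?_
  ext v
  simp
  field_simp

theorem ContinuousLinearMap.IsInvertible.const_smul {F : Type*} [NormedAddCommGroup F]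
    [NormedSpace ℝ F] {B : E →L[ℝ] F} (hB : B.IsInvertible) {c : ℝ} (hc : c ≠ 0) :
    (c • B).IsInvertible := by
  obtain ⟨e, rfl⟩ := hB
  refine ⟨e.trans (ContinuousLinearEquiv.smulLeft (Units.mk0 c hc)), ?_⟩
  ext v
  rfl

variable {B : E →L[ℝ] E →L[ℝ] ℝ} {φ : E → ℝ} {y : E}

theorem conformalCoord_apply (y v w : E) : conformalCoord B φ y v w = (φ y ^ 2)⁻¹ * B v w :=
  rfl

theorem apply_flatGrad (hB : B.IsInvertible) (f : E → ℝ) (y w : E) :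
    B (flatGrad B f y) w = fderiv ℝ f y w :=
  apply_coordGrad (G := fun _ => B) hB f w

theorem hasFDerivAt_flatGrad (B : E →L[ℝ] E →L[ℝ] ℝ) {f : E → ℝ} (hf : ContDiffAt ℝ 2 f y) :
    HasFDerivAt (flatGrad B f) (B.inverse.comp (fderiv ℝ (fderiv ℝ f) y)) y :=
  B.inverse.hasFDerivAt.comp y hf.differentiableAt_fderiv.hasFDerivAt

theorem apply_fderiv_flatGrad (hB : B.IsInvertible) {f : E → ℝ} (hf : ContDiffAt ℝ 2 f y)
    (v w : E) : B (fderiv ℝ (flatGrad B f) y v) w = fderiv ℝ (fderiv ℝ f) y v w := by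
  rw [(hasFDerivAt_flatGrad B hf).fderiv]
  exact congrArg (fun L : E →L[ℝ] ℝ => L w) (hB.self_apply_inverse _)

theorem isMetricAt_conformalCoord (hBs : ∀ v w, B v w = B w v) (hB : B.IsInvertible)
    (hφ : ContDiffAt ℝ 2 φ y) (hφ0 : φ y ≠ 0) : IsMetricAt (conformalCoord B φ) y where
  symm z v w := by rw [conformalCoord_apply, conformalCoord_apply, hBs]
  contDiffAt := ((hφ.pow 2).inv (pow_ne_zero 2 hφ0)).smul contDiffAt_const
  isInvertible := hB.const_smul (inv_ne_zero (pow_ne_zero 2 hφ0))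

theorem fderiv_conformalCoord (hφ : ContDiffAt ℝ 2 φ y) (hφ0 : φ y ≠ 0) (u v w : E) :
    fderiv ℝ (conformalCoord B φ) y u v w =
      -2 * (φ y ^ 3)⁻¹ * fderiv ℝ φ y u * B v w := by
  have h := (hasFDerivAt_inv_sq (hφ.differentiableAt (by norm_num)) hφ0).smul_const B
  have h' : fderiv ℝ (conformalCoord B φ) y = _ := h.fderiv
  rw [h']
  simp

theorem christoffel_conformalCoord (hBs : ∀ v w, B v w = B w v) (hB : B.IsInvertible)
    (hφ : ContDiffAt ℝ 2 φ y) (hφ0 : φ y ≠ 0) (u v : E) :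
    christoffel (conformalCoord B φ) y u v =
      -(φ y)⁻¹ • (fderiv ℝ φ y u • v + fderiv ℝ φ y v • u - B u v • flatGrad B φ y) := by
  refine christoffel_eq (isMetricAt_conformalCoord hBs hB hφ hφ0).isInvertible fun w => ?_
  rw [conformalCoord_apply, christoffelFirst_apply, fderiv_conformalCoord hφ hφ0,
    fderiv_conformalCoord hφ hφ0, fderiv_conformalCoord hφ hφ0]
  simp only [map_sub, map_add, map_smul, sub_apply,
    add_apply, smul_apply, smul_eq_mul, apply_flatGrad hB]
  field_simp
  ring

theorem christoffel_conformalCoord_flip (hBs : ∀ v w, B v w = B w v) (hB : B.IsInvertible)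
    (hφ : ContDiffAt ℝ 2 φ y) (hφ0 : φ y ≠ 0) (v : E) :
    ((christoffel (conformalCoord B φ) y).flip v : E →ₗ[ℝ] E) =
      -(φ y)⁻¹ • ((fderiv ℝ φ y : E →ₗ[ℝ] ℝ).smulRight v + fderiv ℝ φ y v • LinearMap.id -
        (B v : E →ₗ[ℝ] ℝ).smulRight (flatGrad B φ y)) := by
  refine LinearMap.ext fun u => (christoffel_conformalCoord hBs hB hφ hφ0 u v).trans ?_
  simp [hBs u v]

theorem coordHess_conformalCoord (hBs : ∀ v w, B v w = B w v) (hB : B.IsInvertible)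
    (hφ : ContDiffAt ℝ 2 φ y) (hφ0 : φ y ≠ 0) (f : E → ℝ) (v w : E) :
    coordHess (conformalCoord B φ) f y v w =
      fderiv ℝ (fderiv ℝ f) y v w + (φ y)⁻¹ * (fderiv ℝ φ y v * fderiv ℝ f y w +
        fderiv ℝ φ y w * fderiv ℝ f y v - B v w * fderiv ℝ f y (flatGrad B φ y)) := by
  rw [coordHess, christoffel_conformalCoord hBs hB hφ hφ0]
  simp only [map_sub, map_add, map_smul, smul_eq_mul]
  ring

theorem coordGrad_conformalCoord (hB : B.IsInvertible) (hφ0 : φ y ≠ 0) (f : E → ℝ) :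
    coordGrad (conformalCoord B φ) f y = φ y ^ 2 • flatGrad B f y := by
  have h : ((φ y ^ 2)⁻¹ • B).IsInvertible := hB.const_smul (inv_ne_zero (pow_ne_zero 2 hφ0))
  refine h.inverse_apply_eq.2 (ContinuousLinearMap.ext fun w => ?_)
  simp only [map_smul, smul_apply, smul_eq_mul, apply_flatGrad hB]
  field_simp

variable [FiniteDimensional ℝ E]

theorem trace_christoffel_conformalCoord (hBs : ∀ v w, B v w = B w v) (hB : B.IsInvertible)
    (hφ : ContDiffAt ℝ 2 φ y) (hφ0 : φ y ≠ 0) (v : E) :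
    LinearMap.trace ℝ E ((christoffel (conformalCoord B φ) y).flip v : E →ₗ[ℝ] E) =
      -(φ y)⁻¹ * (Module.finrank ℝ E * fderiv ℝ φ y v) := by
  rw [christoffel_conformalCoord_flip hBs hB hφ hφ0]
  simp only [map_sub, map_add, map_smul, LinearMap.trace_smulRight, LinearMap.trace_id,
    smul_eq_mul, ContinuousLinearMap.coe_coe, hBs v (flatGrad B φ y), apply_flatGrad hB]
  ring

theorem fderiv_christoffel_conformalCoord (hBs : ∀ v w, B v w = B w v) (hB : B.IsInvertible)
    (hφ : ContDiffAt ℝ 2 φ y) (hφ0 : φ y ≠ 0) (u v w : E) :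
    fderiv ℝ (christoffel (conformalCoord B φ)) y u v w =
      (φ y ^ 2)⁻¹ • fderiv ℝ φ y u • (fderiv ℝ φ y v • w + fderiv ℝ φ y w • v -
        B v w • flatGrad B φ y) -
      (φ y)⁻¹ • (fderiv ℝ (fderiv ℝ φ) y u v • w + fderiv ℝ (fderiv ℝ φ) y u w • v -
        B v w • fderiv ℝ (flatGrad B φ) y u) := by
  have hev : ∀ᶠ z in 𝓝 y,
      ContinuousLinearMap.id ℝ E (christoffel (conformalCoord B φ) z v w) =
        -(φ z)⁻¹ • (fderiv ℝ φ z v • w + fderiv ℝ φ z w • v - B v w • flatGrad B φ z) := by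
    filter_upwards [hφ.eventually (by simp), hφ.continuousAt.eventually_ne hφ0] with z h1 h2
    exact christoffel_conformalCoord hBs hB h1 h2 v w
  have hd : ∀ a : E, HasFDerivAt (fun z => fderiv ℝ φ z a) _ y := fun a =>
    hφ.differentiableAt_fderiv.hasFDerivAt.clm_apply (hasFDerivAt_const a y)
  have h := fderiv_christoffel_apply
    (isMetricAt_conformalCoord hBs hB hφ hφ0).differentiableAt_christoffel _ hev
    ((((hasDerivAt_inv hφ0).comp_hasFDerivAt y
      (hφ.differentiableAt (by norm_num)).hasFDerivAt).neg).smul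
      ((((hd v).smul_const w).add ((hd w).smul_const v)).sub
        ((hasFDerivAt_flatGrad B hφ).differentiableAt.hasFDerivAt.const_smul (B v w)))) u
  rw [ContinuousLinearMap.id_apply] at h
  rw [h]
  simp
  module

/-- The Ricci tensor of the conformally flat metric `φ⁻² B`. -/
theorem ricciCoord_conformalCoord (hBs : ∀ v w, B v w = B w v) (hB : B.IsInvertible)
    (hφ : ContDiffAt ℝ 2 φ y) (hφ0 : φ y ≠ 0) (v w : E) :
    ricciCoord (conformalCoord B φ) y v w =
      (Module.finrank ℝ E - 2) * (φ y)⁻¹ * fderiv ℝ (fderiv ℝ φ) y v w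
      + B v w * ((φ y)⁻¹ * flatLaplacian B φ y
        - (Module.finrank ℝ E - 1) * (φ y ^ 2)⁻¹ * fderiv ℝ φ y (flatGrad B φ y)) := by
  have hM := isMetricAt_conformalCoord hBs hB hφ hφ0
  have hΓ := christoffel_conformalCoord hBs hB hφ hφ0
  have hDΓ := fderiv_christoffel_conformalCoord hBs hB hφ hφ0
  have hsymm : ∀ a b, fderiv ℝ (fderiv ℝ φ) y a b = fderiv ℝ (fderiv ℝ φ) y b a :=
    (hφ.isSymmSndFDerivAt (by simp)).eq
  have h1 : (((fderiv ℝ (christoffel (conformalCoord B φ)) y).flip v).flip w : E →ₗ[ℝ] E) =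
      (φ y ^ 2)⁻¹ • (fderiv ℝ φ y : E →ₗ[ℝ] ℝ).smulRight
        (fderiv ℝ φ y v • w + fderiv ℝ φ y w • v - B v w • flatGrad B φ y)
      - (φ y)⁻¹ • ((fderiv ℝ (fderiv ℝ φ) y v : E →ₗ[ℝ] ℝ).smulRight w
        + (fderiv ℝ (fderiv ℝ φ) y w : E →ₗ[ℝ] ℝ).smulRight v
        - B v w • (fderiv ℝ (flatGrad B φ) y : E →ₗ[ℝ] E)) := by
    refine LinearMap.ext fun u => (hDΓ u v w).trans ?_
    simp [hsymm u]
  have h2 : ((fderiv ℝ (christoffel (conformalCoord B φ)) y v).flip w : E →ₗ[ℝ] E) =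
      ((φ y ^ 2)⁻¹ * fderiv ℝ φ y v) • ((fderiv ℝ φ y : E →ₗ[ℝ] ℝ).smulRight w
        + fderiv ℝ φ y w • LinearMap.id - (B w : E →ₗ[ℝ] ℝ).smulRight (flatGrad B φ y))
      - (φ y)⁻¹ • ((fderiv ℝ (fderiv ℝ φ) y v : E →ₗ[ℝ] ℝ).smulRight w
        + fderiv ℝ (fderiv ℝ φ) y v w • LinearMap.id
        - (B w : E →ₗ[ℝ] ℝ).smulRight (fderiv ℝ (flatGrad B φ) y v)) := by
    refine LinearMap.ext fun u => (hDΓ v u w).trans ?_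
    simp [hBs u w, mul_smul]
  have h3 : (christoffel (conformalCoord B φ) y v : E →ₗ[ℝ] E) =
      ((christoffel (conformalCoord B φ) y).flip v : E →ₗ[ℝ] E) :=
    LinearMap.ext fun u => hM.christoffel_symm v u
  -- The last curvature term `u ↦ Γ(v, Γ(u, w))`: composing `Γ(v, ·)` with maps of rank one gives maps
  -- of rank one again.
  have h4 : LinearMap.trace ℝ E ((christoffel (conformalCoord B φ) y v : E →ₗ[ℝ] E) ∘ₗ
      ((christoffel (conformalCoord B φ) y).flip w : E →ₗ[ℝ] E)) =
      -(φ y)⁻¹ * (fderiv ℝ φ y (christoffel (conformalCoord B φ) y v w)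
        + fderiv ℝ φ y w * (-(φ y)⁻¹ * (Module.finrank ℝ E * fderiv ℝ φ y v))
        - B w (christoffel (conformalCoord B φ) y v (flatGrad B φ y))) := by
    rw [christoffel_conformalCoord_flip hBs hB hφ hφ0 w, ←
      trace_christoffel_conformalCoord hBs hB hφ hφ0, ← h3]
    have hc : ∀ (a : E →ₗ[ℝ] ℝ) (x : E),
        (christoffel (conformalCoord B φ) y v : E →ₗ[ℝ] E) ∘ₗ a.smulRight x =
          a.smulRight (christoffel (conformalCoord B φ) y v x) := fun a x =>
      LinearMap.ext fun u => map_smul (christoffel (conformalCoord B φ) y v) (a u) x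
    simp only [LinearMap.comp_smul, LinearMap.comp_sub, LinearMap.comp_add, hc, LinearMap.comp_id,
      map_smul, map_sub, map_add, LinearMap.trace_smulRight, smul_eq_mul,
      ContinuousLinearMap.coe_coe]
  -- The four terms in the definition of `curvatureEndo`.
  change LinearMap.trace ℝ E
    ((((fderiv ℝ (christoffel (conformalCoord B φ)) y).flip v).flip w : E →ₗ[ℝ] E)
      - ((fderiv ℝ (christoffel (conformalCoord B φ)) y v).flip w : E →ₗ[ℝ] E)
      + ((christoffel (conformalCoord B φ) y).flip
        (christoffel (conformalCoord B φ) y v w) : E →ₗ[ℝ] E)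
      - (christoffel (conformalCoord B φ) y v : E →ₗ[ℝ] E) ∘ₗ
        ((christoffel (conformalCoord B φ) y).flip w : E →ₗ[ℝ] E)) = _
  rw [map_sub, map_add, map_sub, h4, trace_christoffel_conformalCoord hBs hB hφ hφ0, h1, h2]
  simp only [map_sub, map_add, map_smul, LinearMap.trace_smulRight, LinearMap.trace_id,
    smul_eq_mul, ContinuousLinearMap.coe_coe, hBs w, apply_flatGrad hB, hΓ,
    apply_fderiv_flatGrad hB hφ, sub_apply, add_apply, smul_apply, hBs v (flatGrad B φ y),
    hsymm w v]
  rw [flatLaplacian]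
  field_simp
  ring

theorem coordLaplacian_conformalCoord (hBs : ∀ v w, B v w = B w v) (hB : B.IsInvertible)
    (hφ : ContDiffAt ℝ 2 φ y) (hφ0 : φ y ≠ 0) {f : E → ℝ} (hf : ContDiffAt ℝ 2 f y) :
    coordLaplacian (conformalCoord B φ) f y =
      φ y ^ 2 * flatLaplacian B f y
        - (Module.finrank ℝ E - 2) * φ y * fderiv ℝ φ y (flatGrad B f y) := by
  have hev : coordGrad (conformalCoord B φ) f =ᶠ[𝓝 y] fun z => φ z ^ 2 • flatGrad B f z := by
    filter_upwards [hφ.continuousAt.eventually_ne hφ0] with z h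
    exact coordGrad_conformalCoord hB h f
  have hd : (fderiv ℝ (coordGrad (conformalCoord B φ) f) y : E →ₗ[ℝ] E) =
      φ y ^ 2 • (fderiv ℝ (flatGrad B f) y : E →ₗ[ℝ] E) +
        (2 * φ y) • (fderiv ℝ φ y : E →ₗ[ℝ] ℝ).smulRight (flatGrad B f y) := by
    have h := ((hφ.differentiableAt (by norm_num)).hasFDerivAt.pow 2).smul
      (hasFDerivAt_flatGrad B hf).differentiableAt.hasFDerivAt
    rw [(h.congr_of_eventuallyEq hev).fderiv]
    ext u
    simp [mul_smul]
  change LinearMap.trace ℝ E ((fderiv ℝ (coordGrad (conformalCoord B φ) f) y : E →ₗ[ℝ] E) +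
    ((christoffel (conformalCoord B φ) y).flip (coordGrad (conformalCoord B φ) f y) :
      E →ₗ[ℝ] E)) = _
  rw [map_add, trace_christoffel_conformalCoord hBs hB hφ hφ0, hd,
    coordGrad_conformalCoord hB hφ0]
  simp only [map_add, map_smul, LinearMap.trace_smulRight, smul_eq_mul,
    ContinuousLinearMap.coe_coe, flatLaplacian]
  field_simp
  ring

end ConformalCoordinates

/-! ### From manifolds to coordinates -/

section Manifolds

variable {E : Type*} [NormedAddCommGroup E] [NormedSpace ℝ E]
  {H : Type*} [TopologicalSpace H] {I : ModelWithCorners ℝ E H}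
  {M : Type*} [TopologicalSpace M] [ChartedSpace H M] [IsManifold I ∞ M]

/-- Tangent vectors at `p` are identified with vectors of the model space through the preferred chart
at `p`, so this chart has the identity as derivative at `p`. -/
theorem mfderiv_extChartAt_center (p : M) :
    mfderiv I 𝓘(ℝ, E) (extChartAt I p) p = ContinuousLinearMap.id ℝ E := by
  have : IsManifold I 1 M := IsManifold.of_le (n := ∞) (by simp)
  have h := mdifferentiableAt_extChartAt (I := I) (mem_chart_source H p)
  refine (if_pos h).trans (ContinuousLinearMap.ext fun v => ?_)
  exact tangentCoordChange_self (I := I) (mem_extChartAt_source p)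

theorem mfderivWithin_extChartAt_symm_center (p : M) :
    mfderivWithin 𝓘(ℝ, E) I (extChartAt I p).symm (range I) (extChartAt I p p) =
      ContinuousLinearMap.id ℝ E := by
  have : IsManifold I 1 M := IsManifold.of_le (n := ∞) (by simp)
  have h := mfderiv_extChartAt_comp_mfderivWithin_extChartAt_symm' (I := I) (x := p)
    (y := p) (mem_extChartAt_source p)
  rw [mfderiv_extChartAt_center] at h
  exact h

namespace SemiRiemannianMetric

theorem ricci_eq (g : SemiRiemannianMetric I M) (p : M) (v w : E) :
    g.ricci p v w = ricciCoord (chartRep I g.form p) (extChartAt I p p) v w := by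
  unfold SemiRiemannianMetric.ricci
  rw [mfderiv_extChartAt_center]
  rfl

theorem chartRep_center (g : SemiRiemannianMetric I M) (p : M) (v w : E) :
    chartRep I g.form p (extChartAt I p p) v w = g.form p v w := by
  have h : ∀ q : M, q = p → ∀ L : E →L[ℝ] E, L = ContinuousLinearMap.id ℝ E →
      g.form q (L v) (L w) = g.form p v w := by
    rintro q rfl L rfl
    rfl
  exact h _ (extChartAt_to_inv p) _ (mfderivWithin_extChartAt_symm_center p)

theorem isMetricAt_chartRep [FiniteDimensional ℝ E] [I.Boundaryless]
    (g : SemiRiemannianMetric I M) (p : M) :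
    IsMetricAt (chartRep I g.form p) (extChartAt I p p) where
  symm z v w := g.symm ((extChartAt I p).symm z)
    (mfderivWithin 𝓘(ℝ, E) I (extChartAt I p).symm (range I) z v)
    (mfderivWithin 𝓘(ℝ, E) I (extChartAt I p).symm (range I) z w)
  contDiffAt := ((g.smooth p).contDiffAt
    ((isOpen_extChartAt_target p).mem_nhds (mem_extChartAt_target p))).of_le
    (WithTop.coe_le_coe.2 (le_top : (2 : ℕ∞) ≤ ⊤))
  isInvertible := isInvertible_of_nondegenerate fun v hv =>
    g.nondegenerate p v fun w => (g.chartRep_center p v w).symm.trans (hv w)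

/-- The Einstein condition only involves the chart expression of the metric at the centre of each
preferred chart. -/
theorem isEinstein_iff_center (g : SemiRiemannianMetric I M) (lam : ℝ) :
    g.IsEinstein lam ↔ ∀ (p : M) (v w : E),
      ricciCoord (chartRep I g.form p) (extChartAt I p p) v w =
        lam * chartRep I g.form p (extChartAt I p p) v w := by
  refine forall_congr' fun p => forall_congr' fun v => forall_congr' fun w => ?_
  exact Eq.congr (g.ricci_eq p v w) (congrArg (lam * ·) (g.chartRep_center p v w).symm)

end SemiRiemannianMetric

end Manifolds

/-! ### The warped product over `ℝⁿ` -/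

section PseudoEuclideanBase

variable {n m : ℕ} {ε : Fin n → ℝ}
  {F : Type*} [TopologicalSpace F]
  [ChartedSpace (EuclideanSpace ℝ (Fin m)) F] [IsManifold (𝓡 m) ∞ F]

theorem pseudoEuclideanForm_isInvertible (hε : ∀ i, ε i = 1 ∨ ε i = -1) :
    (pseudoEuclideanForm ε).IsInvertible :=
  isInvertible_of_nondegenerate (pseudoEuclideanForm_nondegenerate ε hε)

theorem flatGrad_pseudoEuclideanForm_apply (hε : ∀ i, ε i = 1 ∨ ε i = -1)
    (u : EuclideanSpace ℝ (Fin n) → ℝ) (x : EuclideanSpace ℝ (Fin n)) (i : Fin n) :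
    flatGrad (pseudoEuclideanForm ε) u x i = ε i * pd i u x := by
  have h := apply_flatGrad (pseudoEuclideanForm_isInvertible hε) u x (EuclideanSpace.single i 1)
  simp [pseudoEuclideanForm_apply] at h
  rw [pd, ← h]
  rcases hε i with h | h <;> simp [h]

theorem fderiv_eq_sum_pd (u : EuclideanSpace ℝ (Fin n) → ℝ) (x v : EuclideanSpace ℝ (Fin n)) :
    fderiv ℝ u x v = ∑ i, v i * pd i u x := by
  conv_lhs => rw [← (EuclideanSpace.basisFun (Fin n) ℝ).sum_repr v]
  simp [pd]

theorem fderiv_flatGrad_pseudoEuclideanForm (hε : ∀ i, ε i = 1 ∨ ε i = -1)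
    (u φ : EuclideanSpace ℝ (Fin n) → ℝ) (x : EuclideanSpace ℝ (Fin n)) :
    fderiv ℝ u x (flatGrad (pseudoEuclideanForm ε) φ x) = ∑ k, ε k * pd k φ x * pd k u x := by
  rw [fderiv_eq_sum_pd]
  exact Finset.sum_congr rfl fun k _ => by rw [flatGrad_pseudoEuclideanForm_apply hε]

theorem pd_pd {u : EuclideanSpace ℝ (Fin n) → ℝ} {x : EuclideanSpace ℝ (Fin n)}
    (hu : ContDiffAt ℝ 2 u x) (i j : Fin n) :
    pd j (pd i u) x =
      fderiv ℝ (fderiv ℝ u) x (EuclideanSpace.single i 1) (EuclideanSpace.single j 1) := by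
  have h : HasFDerivAt (pd i u) _ x :=
    hu.differentiableAt_fderiv.hasFDerivAt.clm_apply
      (hasFDerivAt_const (EuclideanSpace.single i (1 : ℝ)) x)
  rw [pd, h.fderiv, (hu.isSymmSndFDerivAt (by simp)).eq (EuclideanSpace.single i 1)]
  simp

theorem flatLaplacian_pseudoEuclideanForm (hε : ∀ i, ε i = 1 ∨ ε i = -1)
    {u : EuclideanSpace ℝ (Fin n) → ℝ} {x : EuclideanSpace ℝ (Fin n)} (hu : ContDiffAt ℝ 2 u x) :
    flatLaplacian (pseudoEuclideanForm ε) u x = ∑ k, ε k * pd k (pd k u) x := by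
  rw [flatLaplacian, LinearMap.trace_eq_matrix_trace ℝ (EuclideanSpace.basisFun (Fin n) ℝ).toBasis,
    Matrix.trace]
  refine Finset.sum_congr rfl fun k _ => ?_
  have h := apply_fderiv_flatGrad (pseudoEuclideanForm_isInvertible hε) hu
    (EuclideanSpace.single k 1) (EuclideanSpace.single k 1)
  rw [pd_pd hu, ← h]
  rcases hε k with h | h <;>
  simp [LinearMap.toMatrix_apply, pseudoEuclideanForm_apply, h]

/-- Near its centre, the chart expression of the warped product metric is the warped product of the
chart expressions; the chart of `ℝⁿ` is the identity. -/
theorem chartRep_warped_eventuallyEq (hε : ∀ i, ε i = 1 ∨ ε i = -1)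
    (gF : SemiRiemannianMetric (𝓡 m) F)
    (φ f : EuclideanSpace ℝ (Fin n) → ℝ) (hφ : ContDiff ℝ ∞ φ) (hφ0 : ∀ x, φ x ≠ 0)
    (p : EuclideanSpace ℝ (Fin n) × F) :
    chartRep ((𝓡 n).prod (𝓡 m))
        (warpedForm ((pseudoEuclidean ε hε).conformal φ hφ.contMDiff hφ0) f gF) p
      =ᶠ[𝓝 (extChartAt ((𝓡 n).prod (𝓡 m)) p p)]
    warpedCoord (conformalCoord (pseudoEuclideanForm ε) φ) f (chartRep (𝓡 m) gF.form p.2) := by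
  filter_upwards [(isOpen_extChartAt_target p).mem_nhds (mem_extChartAt_target p)] with y hy
  rw [chartRep_warpedForm _ _ _ _ _ hy]
  have h : chartRep (𝓡 n) ((pseudoEuclidean ε hε).conformal φ hφ.contMDiff hφ0).form p.1 y.1 =
      conformalCoord (pseudoEuclideanForm ε) φ y.1 := by
    refine (chartRep_conformalForm _ _ _ _).trans ?_
    exact congrArg₂ (fun (a : ℝ) (b : EuclideanSpace ℝ (Fin n) →L[ℝ] _) => a • b)
      rfl (chartRep_pseudoEuclidean ε p.1 y.1)
  rw [h]
  rfl

/-- The Einstein condition for the warped product, once the Ricci tensor of the fibre is replaced by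
`λ_F g_F`. -/
theorem isEinstein_warped_iff (hε : ∀ i, ε i = 1 ∨ ε i = -1)
    (gF : SemiRiemannianMetric (𝓡 m) F) (lamF : ℝ) (hF : gF.IsEinstein lamF)
    (φ f : EuclideanSpace ℝ (Fin n) → ℝ) (hφ : ContDiff ℝ ∞ φ) (hφ0 : ∀ x, φ x ≠ 0)
    (hf : ContDiff ℝ ∞ f) (hf0 : ∀ x, 0 < f x) (lam : ℝ) :
    (SemiRiemannianMetric.warped ((pseudoEuclidean ε hε).conformal φ hφ.contMDiff hφ0)
        f hf.contMDiff hf0 gF).IsEinstein lam ↔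
      ∀ (x : EuclideanSpace ℝ (Fin n)) (q : F) (v w : EuclideanSpace ℝ (Fin n))
        (v' w' : EuclideanSpace ℝ (Fin m)),
        ricciCoord (conformalCoord (pseudoEuclideanForm ε) φ) x v w
          - m * (f x)⁻¹ * coordHess (conformalCoord (pseudoEuclideanForm ε) φ) f x v w
          + lamF * gF.form q v' w'
          - (f x * coordLaplacian (conformalCoord (pseudoEuclideanForm ε) φ) f x +
            (m - 1) * fderiv ℝ f x (coordGrad (conformalCoord (pseudoEuclideanForm ε) φ) f x)) *
              gF.form q v' w' =
        lam * (conformalCoord (pseudoEuclideanForm ε) φ x v w + f x ^ 2 * gF.form q v' w') := by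
  have hφ2 : ContDiff ℝ 2 φ := hφ.of_le (WithTop.coe_le_coe.2 (le_top : (2 : ℕ∞) ≤ ⊤))
  have hf2 : ContDiff ℝ 2 f := hf.of_le (WithTop.coe_le_coe.2 (le_top : (2 : ℕ∞) ≤ ⊤))
  have key : ∀ (p : EuclideanSpace ℝ (Fin n) × F)
      (v w : EuclideanSpace ℝ (Fin n) × EuclideanSpace ℝ (Fin m)),
      ricciCoord (warpedCoord (conformalCoord (pseudoEuclideanForm ε) φ) f
        (chartRep (𝓡 m) gF.form p.2)) (p.1, extChartAt (𝓡 m) p.2 p.2) v w = _ := fun p v w =>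
    ricciCoord_warpedCoord (z := (p.1, extChartAt (𝓡 m) p.2 p.2))
      (isMetricAt_conformalCoord (pseudoEuclideanForm_symm ε)
      (pseudoEuclideanForm_isInvertible hε) hφ2.contDiffAt (hφ0 p.1)) (gF.isMetricAt_chartRep p.2)
      hf2.contDiffAt (hf0 p.1).ne' v w
  have hcen : ∀ p : EuclideanSpace ℝ (Fin n) × F, extChartAt ((𝓡 n).prod (𝓡 m)) p p =
      (p.1, extChartAt (𝓡 m) p.2 p.2) := fun p => by
    rw [extChartAt_prod]
    rfl
  rw [SemiRiemannianMetric.isEinstein_iff_center]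
  have hFc := (gF.isEinstein_iff_center lamF).1 hF
  have hev := chartRep_warped_eventuallyEq hε gF φ f hφ hφ0
  have main : ∀ (p : EuclideanSpace ℝ (Fin n) × F)
      (v w : EuclideanSpace ℝ (Fin n) × EuclideanSpace ℝ (Fin m)), _ ↔ _ := fun p v w =>
    Eq.congr (congrFun₂ (ricciCoord_congr (hev p)) v w)
      (congrArg (fun L => lam * L v w) (hev p).eq_of_nhds)
  constructor
  · intro h x q v w v' w'
    have h1 := (main (x, q) (v, v') (w, w')).1 (h (x, q) (v, v') (w, w'))
    rw [hcen, key, warpedCoord_apply] at h1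
    simp only [hFc] at h1
    rw [gF.chartRep_center, finrank_euclideanSpace_fin] at h1
    exact h1
  · intro h p v w
    refine (main p v w).2 ?_
    rw [hcen, key, warpedCoord_apply]
    simp only [hFc]
    rw [gF.chartRep_center, finrank_euclideanSpace_fin]
    exact h p.1 p.2 v.1 w.1 v.2 w.2

end PseudoEuclideanBase

/-! ### The Einstein equations in partial derivatives -/

theorem EuclideanSpace.bilin_eq_zero_iff {n : ℕ}
    (T : EuclideanSpace ℝ (Fin n) →L[ℝ] EuclideanSpace ℝ (Fin n) →L[ℝ] ℝ) :
    (∀ v w, T v w = 0) ↔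
      ∀ i j, T (EuclideanSpace.single i 1) (EuclideanSpace.single j 1) = 0 := by
  refine ⟨fun h i j => h _ _, fun h v w => ?_⟩
  rw [← (EuclideanSpace.basisFun (Fin n) ℝ).sum_repr v,
    ← (EuclideanSpace.basisFun (Fin n) ℝ).sum_repr w]
  simp [h]

theorem SemiRiemannianMetric.exists_form_ne_zero {m : ℕ} (hm : 1 ≤ m)
    {F : Type*} [TopologicalSpace F] [ChartedSpace (EuclideanSpace ℝ (Fin m)) F]
    (gF : SemiRiemannianMetric (𝓡 m) F) (q : F) :
    ∃ v w : EuclideanSpace ℝ (Fin m), gF.form q v w ≠ 0 := by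
  by_contra! h
  have h1 : EuclideanSpace.single (⟨0, hm⟩ : Fin m) (1 : ℝ) = 0 :=
    gF.nondegenerate q (EuclideanSpace.single (⟨0, hm⟩ : Fin m) (1 : ℝ)) fun w => h _ w
  simp at h1

/-- The part of `Ric - λ g̃` on vectors tangent to `ℝⁿ`, that is, `Ric - (m / f) Hess f - λ g` for the
metric `g` obtained from the form `∑ ε_i v_i w_i` by division by `φ²`, multiplied by `f φ²`. -/
def horizontalForm {n : ℕ} (m : ℕ) (ε : Fin n → ℝ) (φ f : EuclideanSpace ℝ (Fin n) → ℝ) (lam : ℝ)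
    (x : EuclideanSpace ℝ (Fin n)) :
    EuclideanSpace ℝ (Fin n) →L[ℝ] EuclideanSpace ℝ (Fin n) →L[ℝ] ℝ :=
  φ x • ((n - 2 : ℝ) • f x • fderiv ℝ (fderiv ℝ φ) x - (m : ℝ) • φ x • fderiv ℝ (fderiv ℝ f) x
    - (m : ℝ) • (fderiv ℝ φ x).smulRight (fderiv ℝ f x)
    - (m : ℝ) • (fderiv ℝ f x).smulRight (fderiv ℝ φ x))
  + (f x * φ x * ∑ k, ε k * pd k (pd k φ) x
            - (n - 1 : ℝ) * f x * ∑ k, ε k * pd k φ x ^ 2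
            + m * φ x * ∑ k, ε k * pd k φ x * pd k f x - lam * f x) • pseudoEuclideanForm ε

section EinsteinEquations

variable {n m : ℕ} {ε : Fin n → ℝ} {φ f : EuclideanSpace ℝ (Fin n) → ℝ}
  {x : EuclideanSpace ℝ (Fin n)}

theorem horizontalForm_single (hφ : ContDiffAt ℝ 2 φ x) (hf : ContDiffAt ℝ 2 f x) (lam : ℝ)
    (i j : Fin n) :
    horizontalForm m ε φ f lam x (EuclideanSpace.single i 1) (EuclideanSpace.single j 1) =
      φ x * ((n - 2 : ℝ) * f x * pd j (pd i φ) x - m * φ x * pd j (pd i f) x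
          - m * pd i φ x * pd j f x - m * pd j φ x * pd i f x) +
      (f x * φ x * ∑ k, ε k * pd k (pd k φ) x
            - (n - 1 : ℝ) * f x * ∑ k, ε k * pd k φ x ^ 2
            + m * φ x * ∑ k, ε k * pd k φ x * pd k f x - lam * f x) *
        (if i = j then ε i else 0) := by
  have h : pseudoEuclideanForm ε (EuclideanSpace.single i 1) (EuclideanSpace.single j 1) =
      if i = j then ε i else 0 := by
    rcases eq_or_ne i j with rfl | hij
    · simp [pseudoEuclideanForm_apply]
    · simp [pseudoEuclideanForm_apply, hij, hij.symm]
  simp only [horizontalForm, add_apply, sub_apply, smul_apply, smul_eq_mul,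
    ContinuousLinearMap.smulRight_apply, h, pd_pd hφ i j, pd_pd hf i j]
  simp only [pd]
  ring

theorem horizontal_iff (hε : ∀ i, ε i = 1 ∨ ε i = -1) (hφ : ContDiffAt ℝ 2 φ x)
    (hφ0 : φ x ≠ 0) (hf0 : f x ≠ 0) (lam : ℝ)
    (v w : EuclideanSpace ℝ (Fin n)) :
    ricciCoord (conformalCoord (pseudoEuclideanForm ε) φ) x v w
          - m * (f x)⁻¹ * coordHess (conformalCoord (pseudoEuclideanForm ε) φ) f x v w =
        lam * conformalCoord (pseudoEuclideanForm ε) φ x v w ↔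
      horizontalForm m ε φ f lam x v w = 0 := by
  have hs := pseudoEuclideanForm_symm ε
  have hi := pseudoEuclideanForm_isInvertible hε
  have h : ricciCoord (conformalCoord (pseudoEuclideanForm ε) φ) x v w
          - m * (f x)⁻¹ * coordHess (conformalCoord (pseudoEuclideanForm ε) φ) f x v w -
        lam * conformalCoord (pseudoEuclideanForm ε) φ x v w =
      (f x * φ x ^ 2)⁻¹ * horizontalForm m ε φ f lam x v w := by
    rw [ricciCoord_conformalCoord hs hi hφ hφ0, coordHess_conformalCoord hs hi hφ hφ0,
      conformalCoord_apply, flatLaplacian_pseudoEuclideanForm hε hφ,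
      fderiv_flatGrad_pseudoEuclideanForm hε, fderiv_flatGrad_pseudoEuclideanForm hε,
      finrank_euclideanSpace_fin]
    simp only [horizontalForm, add_apply, sub_apply, smul_apply, smul_eq_mul,
      ContinuousLinearMap.smulRight_apply, sq (pd _ φ x), ← mul_assoc (ε _)]
    field_simp
    ring
  rw [← sub_eq_zero, h, mul_eq_zero_iff_left (inv_ne_zero (mul_ne_zero hf0 (pow_ne_zero 2 hφ0)))]

/-- The coefficient of `g_F` in the Einstein equation, in the coordinates of `ℝⁿ`. -/
theorem vertical_iff (hε : ∀ i, ε i = 1 ∨ ε i = -1) (hφ : ContDiffAt ℝ 2 φ x)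
    (hf : ContDiffAt ℝ 2 f x) (hφ0 : φ x ≠ 0) (lam lamF : ℝ) :
    lamF - (f x * coordLaplacian (conformalCoord (pseudoEuclideanForm ε) φ) f x +
            (m - 1) * fderiv ℝ f x (coordGrad (conformalCoord (pseudoEuclideanForm ε) φ) f x)) =
        lam * f x ^ 2 ↔
      -f x * φ x ^ 2 * ∑ k, ε k * pd k (pd k f) x
          + (n - 2 : ℝ) * f x * φ x * ∑ k, ε k * pd k f x * pd k φ x
          - (m - 1 : ℝ) * φ x ^ 2 * ∑ k, ε k * pd k f x ^ 2 = lam * f x ^ 2 - lamF := by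
  have hs := pseudoEuclideanForm_symm ε
  have hi := pseudoEuclideanForm_isInvertible hε
  rw [coordLaplacian_conformalCoord hs hi hφ hφ0 hf, coordGrad_conformalCoord hi hφ0,
    map_smul, flatLaplacian_pseudoEuclideanForm hε hf,
      fderiv_flatGrad_pseudoEuclideanForm hε, fderiv_flatGrad_pseudoEuclideanForm hε,
      finrank_euclideanSpace_fin, smul_eq_mul]
  simp only [sq (pd _ f x), ← mul_assoc (ε _)]
  constructor <;> intro h <;> linear_combination h

end EinsteinEquations

end

theorem theorem1p1 {n m : ℕ} (hn : 3 ≤ n) (hm : 1 ≤ m)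
    (ε : Fin n → ℝ) (hε : ∀ i, ε i = 1 ∨ ε i = -1)
    {F : Type*} [TopologicalSpace F] [T2Space F] [SecondCountableTopology F] [Nonempty F]
    [ChartedSpace (EuclideanSpace ℝ (Fin m)) F] [IsManifold (𝓡 m) ∞ F]
    (gF : SemiRiemannianMetric (𝓡 m) F) (lamF : ℝ) (hF : gF.IsEinstein lamF)
    (φ f : EuclideanSpace ℝ (Fin n) → ℝ) (hφ : ContDiff ℝ ∞ φ) (hφ0 : ∀ x, φ x ≠ 0)
    (hf : ContDiff ℝ ∞ f) (hf0 : ∀ x, 0 < f x) (lam : ℝ) :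
    (SemiRiemannianMetric.warped ((pseudoEuclidean ε hε).conformal φ hφ.contMDiff hφ0)
        f hf.contMDiff hf0 gF).IsEinstein lam ↔
      (∀ (x : EuclideanSpace ℝ (Fin n)) (i j : Fin n), i ≠ j →
        (n - 2 : ℝ) * f x * pd j (pd i φ) x - m * φ x * pd j (pd i f) x
          - m * pd i φ x * pd j f x - m * pd j φ x * pd i f x = 0) ∧
      (∀ (x : EuclideanSpace ℝ (Fin n)) (i : Fin n),
        φ x * ((n - 2 : ℝ) * f x * pd i (pd i φ) x - m * φ x * pd i (pd i f) x
            - 2 * m * pd i φ x * pd i f x)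
          + ε i * (f x * φ x * ∑ k, ε k * pd k (pd k φ) x
            - (n - 1 : ℝ) * f x * ∑ k, ε k * pd k φ x ^ 2
            + m * φ x * ∑ k, ε k * pd k φ x * pd k f x) = ε i * lam * f x) ∧
      (∀ x : EuclideanSpace ℝ (Fin n),
        -f x * φ x ^ 2 * ∑ k, ε k * pd k (pd k f) x
          + (n - 2 : ℝ) * f x * φ x * ∑ k, ε k * pd k f x * pd k φ x
          - (m - 1 : ℝ) * φ x ^ 2 * ∑ k, ε k * pd k f x ^ 2 = lam * f x ^ 2 - lamF) := by
  have hφ2 : ContDiff ℝ 2 φ := hφ.of_le (WithTop.coe_le_coe.2 (le_top : (2 : ℕ∞) ≤ ⊤))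
  have hf2 : ContDiff ℝ 2 f := hf.of_le (WithTop.coe_le_coe.2 (le_top : (2 : ℕ∞) ≤ ⊤))
  have hH := fun x : EuclideanSpace ℝ (Fin n) => horizontal_iff (m := m) hε (hφ2.contDiffAt (x := x))
    (hφ0 x) (hf0 x).ne' lam
  have hS := fun x : EuclideanSpace ℝ (Fin n) => horizontalForm_single (m := m) (ε := ε)
    (hφ2.contDiffAt (x := x)) hf2.contDiffAt lam
  have hV := fun x : EuclideanSpace ℝ (Fin n) => vertical_iff (m := m) hε
    (hφ2.contDiffAt (x := x)) hf2.contDiffAt (hφ0 x) lam lamF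
  have hz : ∀ q : F, gF.form q (0 : EuclideanSpace ℝ (Fin m)) (0 : EuclideanSpace ℝ (Fin m)) = 0 :=
    fun q => congrArg (fun L : EuclideanSpace ℝ (Fin m) →L[ℝ] ℝ => L 0) (map_zero (gF.form q))
  rw [isEinstein_warped_iff hε gF lamF hF φ f hφ hφ0 hf hf0]
  constructor
  · intro h
    -- Vectors tangent to the base give the first two families of equations.
    have hor : ∀ x i j, horizontalForm m ε φ f lam x (EuclideanSpace.single i 1)
        (EuclideanSpace.single j 1) = 0 := fun x i j => by
      have h1 := h x (Classical.arbitrary F) (EuclideanSpace.single i 1)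
        (EuclideanSpace.single j 1) 0 0
      rw [hz] at h1
      exact (hH x _ _).1 (by linear_combination h1)
    refine ⟨fun x i j hij => ?_, fun x i => ?_, fun x => ?_⟩
    · have h1 := hor x i j
      rw [hS, if_neg hij, mul_zero, add_zero] at h1
      exact (mul_eq_zero.1 h1).resolve_left (hφ0 x)
    · have h1 := hor x i i
      rw [hS, if_pos rfl] at h1
      linear_combination h1
    · -- As `m ≥ 1`, some value of `g_F` is nonzero and can be cancelled.
      obtain ⟨v, w, hvw⟩ := gF.exists_form_ne_zero hm (Classical.arbitrary F)
      have h1 := h x (Classical.arbitrary F) 0 0 v w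
      have h0 := (hH x 0 0).2 (by rw [map_zero])
      refine (hV x).1 (mul_right_cancel₀ hvw ?_)
      linear_combination h1 - h0
  · rintro ⟨h1, h2, h3⟩ x q v w v' w'
    have hor : ∀ v w, horizontalForm m ε φ f lam x v w = 0 := by
      rw [EuclideanSpace.bilin_eq_zero_iff]
      intro i j
      rw [hS]
      split_ifs with hij
      · subst hij
        linear_combination h2 x i
      · rw [h1 x i j hij, mul_zero, mul_zero, add_zero]
    linear_combination (hH x v w).2 (hor v w) + gF.form q v' w' * (hV x).2 (h3 x)
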